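/- Let $K$ be a field, $n \ge 0$, and $S = K[x_1,\dots,x_n]$ with the standard grading $\deg x_i = 1$. Let $M \neq 0$ be a finitely generated $\mathbb{Z}$-graded $S$-module, with graded Betti numbers $\beta_{i,j}(M) = \dim_K \operatorname{Tor}^S_i(M,K)_{j}$, and let $$\operatorname{reg}(M) = \max\{j \in \mathbb{Z} : \beta_{i,i+j}(M) \neq 0 \text{ for some } i \in \mathbb{N}\}$$ be its Castelnuovo–Mumford regularity. For $k \in \{0,\dots,n\}$ put $$d_k(M) = \min\bigl(\{j \in \mathbb{Z} : \beta_{k,k+j}(M) \neq 0\} \cup \{\operatorname{reg}(M)\}\bigr), \qquad \beta_i^{k,\mathrm{lin}}(M) = \beta_{i,i+d_k(M)}(M) \quad (i \ge k).$$ Let $k \in \{0,\dots,n\}$. If $\beta_p^{k,\mathrm{lin}}(M) \neq 0$ for some $p > k$, then $$\beta_{p-1}^{k,\mathrm{lin}}(M) \ge p.$$ -/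

import Mathlib

open MvPolynomial

noncomputable section

/-- The standard `ℤ`-grading of `S = K[x_1, …, x_n]`, `deg x_i = 1`: the piece of degree `j` consists
of the polynomials all of whose monomials have total degree `j` (so it is `0` for `j < 0`). -/
def polyGrading (K : Type*) [Field K] (n : ℕ) (j : ℤ) : Submodule K (MvPolynomial (Fin n) K) where
  carrier := {f | ∀ m ∈ f.support, (m.degree : ℤ) = j}
  zero_mem' := by simp
  add_mem' := by
    intro f g hf hg m hm
    rcases Finset.mem_union.1 (MvPolynomial.support_add hm) with h | h
    · exact hf m h
    · exact hg m h
  smul_mem' := by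
    intro c f hf m hm
    exact hf m (MvPolynomial.support_smul hm)

/-- The piece of degree `j` of the graded free module `⨁_a S(-deg a)`, whose basis element `e_a` has
degree `deg a`: the coefficient of `e_a` is homogeneous of degree `j - deg a`. -/
def freePiece (K : Type*) [Field K] (n : ℕ) {ι : Type*} (deg : ι → ℤ) (j : ℤ) :
    Submodule K (ι →₀ MvPolynomial (Fin n) K) where
  carrier := {f | ∀ a, f a ∈ polyGrading K n (j - deg a)}
  zero_mem' := fun _ => Submodule.zero_mem _
  add_mem' := fun hf hg _ => Submodule.add_mem _ (hf _) (hg _)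
  smul_mem' := fun c _ hf a => Submodule.smul_mem _ c (hf a)

/-- A graded free resolution `⋯ → F_1 → F_0 → M → 0` of the graded `S`-module `M = ⨁_j ℳ j`:
`F_i` is free with a homogeneous basis `(e_a)`, `a ∈ ι i`, where `e_a` has degree `deg i a`, all maps
are `S`-linear of degree `0`, and the sequence is exact. Minimality is not required. -/
structure GradedFreeResolution {K : Type*} [Field K] (n : ℕ) {M : Type*} [AddCommGroup M]
    [Module K M] [Module (MvPolynomial (Fin n) K) M] (ℳ : ℤ → Submodule K M) where
  ι : ℕ → Type*
  deg : ∀ i, ι i → ℤ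
  ε : (ι 0 →₀ MvPolynomial (Fin n) K) →ₗ[MvPolynomial (Fin n) K] M
  d : ∀ i, (ι (i + 1) →₀ MvPolynomial (Fin n) K) →ₗ[MvPolynomial (Fin n) K]
    (ι i →₀ MvPolynomial (Fin n) K)
  ε_homogeneous : ∀ a, ε (Finsupp.single a 1) ∈ ℳ (deg 0 a)
  d_homogeneous : ∀ i a, d i (Finsupp.single a 1) ∈ freePiece K n (deg i) (deg (i + 1) a)
  ε_surjective : Function.Surjective ε
  exact_zero : Function.Exact (d 0) ε
  exact_succ : ∀ i, Function.Exact (d (i + 1)) (d i)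

namespace GradedFreeResolution

variable {K : Type*} [Field K] {n : ℕ} {M : Type*} [AddCommGroup M]
  [Module K M] [Module (MvPolynomial (Fin n) K) M] {ℳ : ℤ → Submodule K M}

/-- The differential `F_{i+1} ⊗_S K → F_i ⊗_S K`, where `K = S / (x_1, …, x_n)`. In the bases
`e_a ⊗ 1` its matrix consists of the constant coefficients of the matrix entries of `d i`. -/
def tensorD (F : GradedFreeResolution n ℳ) (i : ℕ) : (F.ι (i + 1) →₀ K) →ₗ[K] (F.ι i →₀ K) :=
  Finsupp.linearCombination K fun a =>
    (F.d i (Finsupp.single a 1)).mapRange (constantCoeff (σ := Fin n) (R := K)) (map_zero _)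

/-- The piece `(F_i ⊗_S K)_j`, spanned by the `e_a ⊗ 1` with `e_a` of degree `j`. -/
def tensorPiece (F : GradedFreeResolution n ℳ) (i : ℕ) (j : ℤ) : Submodule K (F.ι i →₀ K) :=
  Finsupp.supported K K {a | F.deg i a = j}

/-- The cycles of homological degree `i` and internal degree `j` in `F ⊗_S K`. -/
def torCycles (F : GradedFreeResolution n ℳ) : (i : ℕ) → (j : ℤ) → Submodule K (F.ι i →₀ K)
  | 0, j => F.tensorPiece 0 j
  | i + 1, j => F.tensorPiece (i + 1) j ⊓ LinearMap.ker (F.tensorD i)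

/-- The boundaries of homological degree `i` and internal degree `j` in `F ⊗_S K`. -/
def torBoundaries (F : GradedFreeResolution n ℳ) (i : ℕ) (j : ℤ) : Submodule K (F.ι i →₀ K) :=
  (F.tensorPiece (i + 1) j).map (F.tensorD i)

/-- `Tor_i^S(M, K)_j`, the piece of degree `j` of the `i`-th homology of `F ⊗_S K`: cycles modulo
boundaries, as a subspace of `(F_i ⊗_S K) / boundaries`. -/
def tor (F : GradedFreeResolution n ℳ) (i : ℕ) (j : ℤ) :
    Submodule K ((F.ι i →₀ K) ⧸ F.torBoundaries i j) :=
  (F.torCycles i j).map (F.torBoundaries i j).mkQ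

/-- The graded Betti number `β_{i,j}(M) = dim_K Tor_i^S(M, K)_j`. -/
def betti (F : GradedFreeResolution n ℳ) (i : ℕ) (j : ℤ) : ℕ :=
  Module.finrank K (F.tor i j)

/-- The Castelnuovo–Mumford regularity `reg M = max {j : β_{i,i+j}(M) ≠ 0 for some i}`. -/
def reg (F : GradedFreeResolution n ℳ) : ℤ :=
  sSup {j : ℤ | ∃ i : ℕ, F.betti i (i + j) ≠ 0}

/-- `d_k(M) = min ({j : β_{k,k+j}(M) ≠ 0} ∪ {reg M})`. -/
def initialDegree (F : GradedFreeResolution n ℳ) (k : ℕ) : ℤ :=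
  sInf ({j : ℤ | F.betti k (k + j) ≠ 0} ∪ {F.reg})

/-- `β_i^{k,lin}(M) = β_{i,i+d_k(M)}(M)`, used for `i ≥ k`. -/
def linBetti (F : GradedFreeResolution n ℳ) (k i : ℕ) : ℕ :=
  F.betti i (i + F.initialDegree k)

end GradedFreeResolution

end

/-! Put `q = p - 1` and `e = p + d_k(M)`. Suppose `β_{q,e-1} ≤ q`; the claim is that every cycle `v`
of `F_{q+1} ⊗ K` of degree `e` is a boundary. Lift `v` to a vector `z` of constants in `F_{q+1}`.
Since `v` is a cycle, `d z` has order at least 1, and its coefficients at `x_1, …, x_n` represent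
classes in `Tor_q(M,K)_{e-1}`. In a basis `(b_a)` of that space the linear part of `d z` reads `∑
b_a ⊗ l_a`, with at most `q` linear forms `l_a`. Let `J` be the ideal they generate.

Modulo `J` the linear part of `d z` is a boundary, so `z` can be corrected by terms of positive
order until `d z` has order at least 2 modulo `J`. From then on the leading coefficients, in order
`s ≥ 2`, are cycles in degree `e - s < e - 1`, where `Tor_q` vanishes; the correction can be
repeated, and the order grows without bound (`exists_orderGE_succ`, `coeffVec_mem_range`). Once `e -
s` is below all degrees of `M`, contractibility of the resolution in low degrees (`exists_homotopy`)
absorbs the remaining error, and `z`, changed only in positive order, becomes a cycle of `F ⊗ S/J`.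
As `J` is generated by at most `q` linear forms, `Tor_{q+1}(M, S/J) = 0` (`exists_cyclesMod_le`). So
`z` is a boundary modulo `J`, and constant terms exhibit `v` as a boundary.

The vanishing of `Tor_q` in degrees below `q + d_k(M)` propagates from `Tor_k` by the same argument
with `J = 0` (`torCycles_le_of_forall_lt`). -/

noncomputable section

/-! ### Linear substitutions and ideals generated by linear forms -/

section Polynomial

variable {K : Type*} [Field K] {n : ℕ}

/-- The linear form `∑ v_i x_i`. -/
def linForm (K : Type*) [Field K] (n : ℕ) : (Fin n → K) →ₗ[K] MvPolynomial (Fin n) K :=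
  Fintype.linearCombination K X

/-- The substitution `x_i ↦ π(x_i)` induced by an endomorphism `π` of the space of linear forms. -/
def substHom (π : (Fin n → K) →ₗ[K] (Fin n → K)) :
    MvPolynomial (Fin n) K →ₐ[K] MvPolynomial (Fin n) K :=
  aeval fun i => linForm K n (π (Pi.single i 1))

lemma linForm_single (i : Fin n) : linForm K n (Pi.single i 1) = X i := by
  simp [linForm]

lemma coeff_linForm_single (v : Fin n → K) (i : Fin n) :
    coeff (Finsupp.single i 1) (linForm K n v) = v i := by
  simp [linForm, Fintype.linearCombination_apply, coeff_sum, coeff_X, Finsupp.single_left_inj]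

lemma linForm_isHomogeneous (v : Fin n → K) : (linForm K n v).IsHomogeneous 1 := by
  rw [linForm, Fintype.linearCombination_apply]
  refine IsHomogeneous.sum _ _ _ fun i _ => ?_
  rw [smul_eq_C_mul]
  simpa using (isHomogeneous_C (Fin n) (v i)).mul (isHomogeneous_X K i)

lemma substHom_linForm (π : (Fin n → K) →ₗ[K] (Fin n → K)) (v : Fin n → K) :
    substHom π (linForm K n v) = linForm K n (π v) := by
  suffices h : (substHom π).toLinearMap ∘ₗ linForm K n = linForm K n ∘ₗ π from
    LinearMap.congr_fun h v
  refine LinearMap.pi_ext' fun i => LinearMap.ext_ring ?_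
  simp [linForm_single, substHom]

lemma substHom_id (f : MvPolynomial (Fin n) K) : substHom LinearMap.id f = f := by
  simp [substHom, linForm_single]

lemma substHom_substHom {π : (Fin n → K) →ₗ[K] (Fin n → K)} (hπ : ∀ v, π (π v) = π v)
    (f : MvPolynomial (Fin n) K) : substHom π (substHom π f) = substHom π f := by
  suffices h : (substHom π).comp (substHom π) = substHom π from DFunLike.congr_fun h f
  refine algHom_ext fun i => ?_
  rw [AlgHom.comp_apply]
  conv_lhs => rw [substHom, aeval_X, ← substHom, substHom_linForm, hπ]
  rw [substHom, aeval_X]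

lemma isHomogeneous_substHom (π : (Fin n → K) →ₗ[K] (Fin n → K)) {f : MvPolynomial (Fin n) K}
    {m : ℕ} (hf : f.IsHomogeneous m) : (substHom π f).IsHomogeneous m := by
  rw [substHom]
  simpa only [one_mul] using hf.aeval (fun i => linForm K n (π (Pi.single i 1)))
    fun i => linForm_isHomogeneous _

lemma coeff_substHom_monomial (π : (Fin n → K) →ₗ[K] (Fin n → K)) {μ ν : Fin n →₀ ℕ}
    (h : ν.degree ≠ μ.degree) (c : K) : coeff ν (substHom π (monomial μ c)) = 0 :=
  (isHomogeneous_substHom π (isHomogeneous_monomial c rfl)).coeff_eq_zero h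

/-- Substitution acts on each graded piece by the matrix of its action on monomials. -/
lemma coeff_substHom (π : (Fin n → K) →ₗ[K] (Fin n → K)) (f : MvPolynomial (Fin n) K)
    (ν : Fin n →₀ ℕ) :
    coeff ν (substHom π f) = ∑ μ ∈ Finset.univ.finsuppAntidiag ν.degree,
      coeff ν (substHom π (monomial μ 1)) * coeff μ f := by
  classical
  induction f using MvPolynomial.induction_on' with
  | monomial κ c =>
    have hc : monomial κ c = c • monomial κ (1 : K) := by simp [smul_monomial]
    rw [hc, map_smul, coeff_smul, smul_eq_mul]
    by_cases h : ν.degree = κ.degree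
    · rw [Finset.sum_eq_single κ]
      · simp [mul_comm]
      · intro b _ hb
        simp [coeff_monomial, hb.symm]
      · intro hκ
        refine absurd ?_ hκ
        simp [Finset.mem_finsuppAntidiag, h, Finsupp.degree_eq_sum]
    · rw [coeff_substHom_monomial π h, mul_zero, Finset.sum_eq_zero]
      intro b hb
      have hb' : b.degree = ν.degree := by
        rw [Finset.mem_finsuppAntidiag] at hb
        rw [← hb.1, Finsupp.degree_eq_sum]
      have : κ ≠ b := by rintro rfl; exact h hb'.symm
      simp [coeff_monomial, this]
  | add p q hp hq => simp only [map_add, coeff_add, hp, hq, mul_add, Finset.sum_add_distrib]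

lemma coeff_zero_substHom (π : (Fin n → K) →ₗ[K] (Fin n → K)) (f : MvPolynomial (Fin n) K) :
    coeff 0 (substHom π f) = coeff 0 f := by
  rw [coeff_substHom]
  simp

/-- An idempotent substitution is a retraction of `S` whose image is a copy of `S/J`. Hence
`substHom π f` is a normal form of `f` modulo `J`, and orders and coefficients modulo `J` make sense
inside `S` itself. -/
lemma ker_substHom {π : (Fin n → K) →ₗ[K] (Fin n → K)} (hπ : ∀ v, π (π v) = π v)
    {T : Set (Fin n → K)} (hT : Submodule.span K T = LinearMap.ker π) :
    RingHom.ker (substHom π) = Ideal.span (linForm K n '' T) := by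
  apply le_antisymm
  · intro f hf
    have hmem : ∀ v ∈ LinearMap.ker π, linForm K n v ∈ Ideal.span (linForm K n '' T) := by
      intro v hv
      rw [← hT] at hv
      induction hv using Submodule.span_induction with
      | mem v hv => exact Ideal.subset_span ⟨v, hv, rfl⟩
      | zero => simp
      | add v w _ _ hv hw => rw [map_add]; exact add_mem hv hw
      | smul c v _ hv => rw [map_smul, smul_eq_C_mul]; exact Ideal.mul_mem_left _ _ hv
    -- Modulo the ideal the substitution is the identity, because `v - π v` lies in the kernel of
    -- the idempotent `π`.
    have key : (Ideal.Quotient.mkₐ K (Ideal.span (linForm K n '' T))).comp (substHom π) =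
        Ideal.Quotient.mkₐ K (Ideal.span (linForm K n '' T)) := by
      refine algHom_ext fun i => ?_
      rw [AlgHom.comp_apply, ← linForm_single, substHom_linForm, Ideal.Quotient.mkₐ_eq_mk,
        Ideal.Quotient.eq, ← map_sub]
      exact hmem _ (by simp [hπ])
    have := DFunLike.congr_fun key f
    rw [AlgHom.comp_apply, (RingHom.mem_ker.1 hf : substHom π f = 0), map_zero] at this
    exact Ideal.Quotient.eq_zero_iff_mem.1 this.symm
  · rw [Ideal.span_le]
    rintro _ ⟨v, hv, rfl⟩
    have : v ∈ LinearMap.ker π := hT ▸ Submodule.subset_span hv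
    simp [RingHom.mem_ker, substHom_linForm, LinearMap.mem_ker.1 this]

lemma exists_idempotent_ker_eq (W : Submodule K (Fin n → K)) :
    ∃ π : (Fin n → K) →ₗ[K] (Fin n → K), (∀ v, π (π v) = π v) ∧ LinearMap.ker π = W := by
  obtain ⟨W', h⟩ := W.exists_isCompl
  refine ⟨W'.projection W h.symm, fun v => ?_, ?_⟩
  · simp
  · simp

/-- The ideal is the kernel of a ring map into a domain. Primality makes every further linear form
outside it a nonzerodivisor on the quotient. -/
lemma isPrime_span_linForm (T : Set (Fin n → K)) : (Ideal.span (linForm K n '' T)).IsPrime := by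
  obtain ⟨π, hπ, hker⟩ := exists_idempotent_ker_eq (Submodule.span K T)
  rw [← ker_substHom hπ hker.symm]
  exact RingHom.ker_isPrime _

lemma coeff_mul_of_lt {f g : MvPolynomial (Fin n) K} {s : ℕ}
    (hf : ∀ ν : Fin n →₀ ℕ, ν.degree < s → coeff ν f = 0) {μ : Fin n →₀ ℕ} (hμ : μ.degree < s) :
    coeff μ (f * g) = 0 := by
  classical
  rw [coeff_mul]
  refine Finset.sum_eq_zero fun x hx => ?_
  rw [Finset.HasAntidiagonal.mem_antidiagonal] at hx
  rw [hf x.1, zero_mul]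
  have := congrArg Finsupp.degree hx
  rw [map_add] at this
  omega

lemma coeff_mul_of_degree_eq {f g : MvPolynomial (Fin n) K} {s : ℕ}
    (hf : ∀ ν : Fin n →₀ ℕ, ν.degree < s → coeff ν f = 0) {μ : Fin n →₀ ℕ} (hμ : μ.degree = s) :
    coeff μ (f * g) = coeff μ f * coeff 0 g := by
  classical
  rw [coeff_mul, Finset.sum_eq_single (μ, 0)]
  · intro x hx hne
    rw [Finset.HasAntidiagonal.mem_antidiagonal] at hx
    have := congrArg Finsupp.degree hx
    rw [map_add] at this
    rw [hf x.1, zero_mul]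
    by_contra hlt
    have h2 : x.2 = 0 := by
      rw [← Finsupp.degree_eq_zero_iff]
      omega
    apply hne
    ext1
    · simpa [h2] using hx
    · exact h2
  · simp

lemma mul_mem_polyGrading {f g : MvPolynomial (Fin n) K} {i j : ℤ} (hf : f ∈ polyGrading K n i)
    (hg : g ∈ polyGrading K n j) : f * g ∈ polyGrading K n (i + j) := by
  classical
  intro m hm
  obtain ⟨a, ha, b, hb, rfl⟩ := Finset.mem_add.1 (support_mul f g hm)
  rw [map_add, Nat.cast_add, hf a ha, hg b hb]

lemma monomial_mem_polyGrading (m : Fin n →₀ ℕ) (c : K) :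
    monomial m c ∈ polyGrading K n m.degree := by
  intro a ha
  rw [Finset.mem_singleton.1 (support_monomial_subset ha)]

lemma substHom_mem_polyGrading (π : (Fin n → K) →ₗ[K] (Fin n → K)) {f : MvPolynomial (Fin n) K}
    {j : ℤ} (hf : f ∈ polyGrading K n j) : substHom π f ∈ polyGrading K n j := by
  intro ν hν
  by_contra hne
  rw [mem_support_iff, coeff_substHom] at hν
  refine hν (Finset.sum_eq_zero fun μ hμ => ?_)
  have hdeg : μ.degree = ν.degree := by
    rw [Finset.mem_finsuppAntidiag] at hμ
    rw [← hμ.1, Finsupp.degree_eq_sum]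
  rw [notMem_support_iff.1 fun h => hne (hdeg ▸ hf μ h), mul_zero]

end Polynomial

/-! ### Vectors of polynomials: coefficients, orders, reduction modulo linear forms -/

section FreeModule

variable {K : Type*} [Field K] {n : ℕ} {α β : Type*}

/-- The coefficients at the monomial `μ` of all entries of a vector. -/
def coeffVec (K : Type*) [Field K] {n : ℕ} (α : Type*) (μ : Fin n →₀ ℕ) :
    (α →₀ MvPolynomial (Fin n) K) →ₗ[K] (α →₀ K) :=
  Finsupp.mapRange.linearMap (lcoeff K μ)

/-- The vector of monomials `c_a x^μ`. -/
def monomialVec (K : Type*) [Field K] {n : ℕ} (α : Type*) (μ : Fin n →₀ ℕ) :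
    (α →₀ K) →ₗ[K] (α →₀ MvPolynomial (Fin n) K) :=
  Finsupp.mapRange.linearMap (monomial μ)

/-- The substitution `substHom π` applied to all entries of a vector. -/
def substVec (α : Type*) (π : (Fin n → K) →ₗ[K] (Fin n → K)) :
    (α →₀ MvPolynomial (Fin n) K) →ₗ[K] (α →₀ MvPolynomial (Fin n) K) :=
  Finsupp.mapRange.linearMap (substHom π).toLinearMap

/-- The vectors all of whose entries lie in the ideal `J`. -/
def coeffIn (α : Type*) (J : Ideal (MvPolynomial (Fin n) K)) :
    Submodule (MvPolynomial (Fin n) K) (α →₀ MvPolynomial (Fin n) K) :=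
  Finsupp.submodule fun _ => J

/-- The vectors all of whose entries have order at least `s`. -/
def orderGE (K : Type*) [Field K] (n : ℕ) (α : Type*) (s : ℕ) :
    Submodule K (α →₀ MvPolynomial (Fin n) K) :=
  ⨅ (μ : Fin n →₀ ℕ) (_ : μ.degree < s), LinearMap.ker (coeffVec K α μ)

/-- The map `D ⊗_S K` of a map `D` of free modules. -/
def reduceMap (D : (α →₀ MvPolynomial (Fin n) K) →ₗ[MvPolynomial (Fin n) K]
    (β →₀ MvPolynomial (Fin n) K)) : (α →₀ K) →ₗ[K] (β →₀ K) :=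
  Finsupp.linearCombination K fun a =>
    (D (Finsupp.single a 1)).mapRange (constantCoeff (σ := Fin n) (R := K)) (map_zero _)

@[simp] lemma coeffVec_apply (μ : Fin n →₀ ℕ) (y : α →₀ MvPolynomial (Fin n) K) (a : α) :
    coeffVec K α μ y a = coeff μ (y a) := rfl

@[simp] lemma monomialVec_apply (μ : Fin n →₀ ℕ) (v : α →₀ K) (a : α) :
    monomialVec K α μ v a = monomial μ (v a) := rfl

@[simp] lemma substVec_apply (π : (Fin n → K) →ₗ[K] (Fin n → K))
    (y : α →₀ MvPolynomial (Fin n) K) (a : α) : substVec α π y a = substHom π (y a) := rfl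

lemma mem_coeffIn {J : Ideal (MvPolynomial (Fin n) K)} {y : α →₀ MvPolynomial (Fin n) K} :
    y ∈ coeffIn α J ↔ ∀ a, y a ∈ J := Iff.rfl

lemma mem_orderGE {s : ℕ} {y : α →₀ MvPolynomial (Fin n) K} :
    y ∈ orderGE K n α s ↔ ∀ μ : Fin n →₀ ℕ, μ.degree < s → coeffVec K α μ y = 0 := by
  simp [orderGE]

lemma coeff_eq_zero_of_mem_orderGE {s : ℕ} {y : α →₀ MvPolynomial (Fin n) K}
    (hy : y ∈ orderGE K n α s) (a : α) {μ : Fin n →₀ ℕ} (hμ : μ.degree < s) :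
    coeff μ (y a) = 0 :=
  DFunLike.congr_fun (mem_orderGE.1 hy μ hμ) a

lemma map_eq_sum (D : (α →₀ MvPolynomial (Fin n) K) →ₗ[MvPolynomial (Fin n) K]
    (β →₀ MvPolynomial (Fin n) K)) (y : α →₀ MvPolynomial (Fin n) K) (b : β) :
    D y b = y.sum fun a f => f * D (Finsupp.single a 1) b := by
  conv_lhs => rw [← Finsupp.sum_single y]
  rw [Finsupp.sum, map_sum, Finsupp.finsetSum_apply, Finsupp.sum]
  refine Finset.sum_congr rfl fun a _ => ?_
  rw [← smul_eq_mul, ← Finsupp.smul_apply, ← map_smul, Finsupp.smul_single_one]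

lemma map_mem_coeffIn (D : (α →₀ MvPolynomial (Fin n) K) →ₗ[MvPolynomial (Fin n) K]
    (β →₀ MvPolynomial (Fin n) K)) {J : Ideal (MvPolynomial (Fin n) K)}
    {y : α →₀ MvPolynomial (Fin n) K} (hy : y ∈ coeffIn α J) : D y ∈ coeffIn β J := by
  intro b
  rw [map_eq_sum]
  exact J.sum_mem fun a _ => J.mul_mem_right _ (hy a)

lemma map_mem_freePiece (D : (α →₀ MvPolynomial (Fin n) K) →ₗ[MvPolynomial (Fin n) K]
    (β →₀ MvPolynomial (Fin n) K)) {degα : α → ℤ} {degβ : β → ℤ}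
    (hD : ∀ a, D (Finsupp.single a 1) ∈ freePiece K n degβ (degα a)) {e : ℤ}
    {y : α →₀ MvPolynomial (Fin n) K} (hy : y ∈ freePiece K n degα e) :
    D y ∈ freePiece K n degβ e := by
  intro b
  rw [map_eq_sum]
  refine Submodule.sum_mem _ fun a _ => ?_
  have := mul_mem_polyGrading (hy a) (hD a b)
  rwa [sub_add_sub_cancel] at this

lemma substVec_mem_freePiece (π : (Fin n → K) →ₗ[K] (Fin n → K)) {deg : α → ℤ} {e : ℤ}
    {y : α →₀ MvPolynomial (Fin n) K} (hy : y ∈ freePiece K n deg e) :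
    substVec α π y ∈ freePiece K n deg e :=
  fun a => substHom_mem_polyGrading π (hy a)

lemma monomialVec_mem_freePiece {deg : α → ℤ} {e : ℤ} (μ : Fin n →₀ ℕ) {v : α →₀ K}
    (hv : v ∈ Finsupp.supported K K {a | deg a = e - μ.degree}) :
    monomialVec K α μ v ∈ freePiece K n deg e := by
  intro a
  by_cases h : v a = 0
  · rw [monomialVec_apply, h, map_zero]
    exact Submodule.zero_mem _
  · have ha : deg a = e - μ.degree := hv (Finsupp.mem_support_iff.2 h)
    have := monomial_mem_polyGrading μ (v a)
    rwa [monomialVec_apply, ha, sub_sub_cancel]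

lemma coeffVec_mem_supported {deg : α → ℤ} {e : ℤ} {y : α →₀ MvPolynomial (Fin n) K}
    (hy : y ∈ freePiece K n deg e) (μ : Fin n →₀ ℕ) :
    coeffVec K α μ y ∈ Finsupp.supported K K {a | deg a = e - μ.degree} := by
  intro a ha
  have h : coeff μ (y a) ≠ 0 := (Finsupp.mem_support_iff (f := coeffVec K α μ y)).1 ha
  have := hy a μ (mem_support_iff.2 h)
  simp only [Set.mem_ofPred_eq]
  omega

lemma coeffVec_zero_substVec (π : (Fin n → K) →ₗ[K] (Fin n → K))
    (y : α →₀ MvPolynomial (Fin n) K) : coeffVec K α 0 (substVec α π y) = coeffVec K α 0 y := by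
  ext a
  simp [coeff_zero_substHom]

lemma substVec_map (π : (Fin n → K) →ₗ[K] (Fin n → K))
    (D : (α →₀ MvPolynomial (Fin n) K) →ₗ[MvPolynomial (Fin n) K]
      (β →₀ MvPolynomial (Fin n) K)) (y : α →₀ MvPolynomial (Fin n) K) (b : β) :
    substVec β π (D y) b =
      y.sum fun a f => substHom π f * substHom π (D (Finsupp.single a 1) b) := by
  rw [substVec_apply, map_eq_sum, Finsupp.sum, map_sum, Finsupp.sum]
  simp only [map_mul]

lemma substVec_substVec {π : (Fin n → K) →ₗ[K] (Fin n → K)} (hπ : ∀ v, π (π v) = π v)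
    (y : α →₀ MvPolynomial (Fin n) K) : substVec α π (substVec α π y) = substVec α π y := by
  ext1 a
  exact substHom_substHom hπ _

lemma substVec_id (y : α →₀ MvPolynomial (Fin n) K) : substVec α LinearMap.id y = y := by
  ext1 a
  exact substHom_id _

lemma substVec_map_substVec {π : (Fin n → K) →ₗ[K] (Fin n → K)} (hπ : ∀ v, π (π v) = π v)
    (D : (α →₀ MvPolynomial (Fin n) K) →ₗ[MvPolynomial (Fin n) K]
      (β →₀ MvPolynomial (Fin n) K)) (y : α →₀ MvPolynomial (Fin n) K) :
    substVec β π (D (substVec α π y)) = substVec β π (D y) := by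
  ext1 b
  rw [substVec_map, substVec_map]
  refine (Finsupp.sum_mapRange_index (hf := map_zero (substHom π).toLinearMap)
    (by simp)).trans ?_
  simp only [AlgHom.toLinearMap_apply, substHom_substHom hπ]

lemma reduceMap_apply (D : (α →₀ MvPolynomial (Fin n) K) →ₗ[MvPolynomial (Fin n) K]
    (β →₀ MvPolynomial (Fin n) K)) (v : α →₀ K) (b : β) :
    reduceMap D v b = v.sum fun a c => c * coeff 0 (D (Finsupp.single a 1) b) := by
  rw [reduceMap, Finsupp.linearCombination_apply, Finsupp.sum, Finsupp.finsetSum_apply,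
    Finsupp.sum]
  simp [constantCoeff_eq]

/-- The leading coefficients of `D y` are the images of those of `y` under `D ⊗_S K`. -/
lemma coeffVec_substVec_map {π : (Fin n → K) →ₗ[K] (Fin n → K)}
    (D : (α →₀ MvPolynomial (Fin n) K) →ₗ[MvPolynomial (Fin n) K]
      (β →₀ MvPolynomial (Fin n) K)) {y : α →₀ MvPolynomial (Fin n) K} {s : ℕ}
    (hy : substVec α π y ∈ orderGE K n α s) {μ : Fin n →₀ ℕ} (hμ : μ.degree = s) :
    coeffVec K β μ (substVec β π (D y)) = reduceMap D (coeffVec K α μ (substVec α π y)) := by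
  ext b
  rw [coeffVec_apply, substVec_map, reduceMap_apply, Finsupp.sum, coeff_sum]
  refine Eq.trans ?_ (Finsupp.sum_mapRange_index (hf := map_zero (lcoeff K μ)) (by simp)).symm
  refine Eq.trans ?_ (Finsupp.sum_mapRange_index (hf := map_zero (substHom π).toLinearMap)
    (by simp)).symm
  refine Finset.sum_congr rfl fun a _ => ?_
  rw [coeff_mul_of_degree_eq (f := substHom π (y a))
    (fun ν hν => coeff_eq_zero_of_mem_orderGE hy a hν) hμ, coeff_zero_substHom]
  rfl

lemma substVec_map_mem_orderGE {π : (Fin n → K) →ₗ[K] (Fin n → K)}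
    (D : (α →₀ MvPolynomial (Fin n) K) →ₗ[MvPolynomial (Fin n) K]
      (β →₀ MvPolynomial (Fin n) K)) {y : α →₀ MvPolynomial (Fin n) K} {s : ℕ}
    (hy : substVec α π y ∈ orderGE K n α s) : substVec β π (D y) ∈ orderGE K n β s := by
  rw [mem_orderGE]
  intro μ hμ
  ext b
  rw [coeffVec_apply, substVec_map, Finsupp.sum, coeff_sum]
  exact Finset.sum_eq_zero fun a _ =>
    coeff_mul_of_lt (fun ν hν => coeff_eq_zero_of_mem_orderGE hy a hν) hμ

lemma coeffVec_zero_map (D : (α →₀ MvPolynomial (Fin n) K) →ₗ[MvPolynomial (Fin n) K]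
      (β →₀ MvPolynomial (Fin n) K)) (y : α →₀ MvPolynomial (Fin n) K) :
    coeffVec K β 0 (D y) = reduceMap D (coeffVec K α 0 y) := by
  have := coeffVec_substVec_map (π := LinearMap.id) D (y := y) (s := 0) (μ := 0)
    (mem_orderGE.2 fun μ hμ => absurd hμ (Nat.not_lt_zero _)) (by simp)
  rwa [substVec_id, substVec_id] at this

lemma coeffVec_zero_monomialVec_zero (v : α →₀ K) :
    coeffVec K α (0 : Fin n →₀ ℕ) (monomialVec K α 0 v) = v := by
  ext a
  simp

lemma coeffVec_substVec (π : (Fin n → K) →ₗ[K] (Fin n → K)) (y : α →₀ MvPolynomial (Fin n) K)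
    (ν : Fin n →₀ ℕ) :
    coeffVec K α ν (substVec α π y) = ∑ μ ∈ Finset.univ.finsuppAntidiag ν.degree,
      coeff ν (substHom π (monomial μ 1)) • coeffVec K α μ y := by
  ext a
  simp [coeff_substHom π (y a), Finsupp.finsetSum_apply]

lemma coeffVec_monomialVec (μ ν : Fin n →₀ ℕ) (v : α →₀ K) :
    coeffVec K α ν (monomialVec K α μ v) = if μ = ν then v else 0 := by
  classical
  ext a
  rw [coeffVec_apply, monomialVec_apply, coeff_monomial]
  split_ifs <;> rfl

lemma substVec_eq_zero_iff {π : (Fin n → K) →ₗ[K] (Fin n → K)} (hπ : ∀ v, π (π v) = π v)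
    {T : Set (Fin n → K)} (hT : Submodule.span K T = LinearMap.ker π)
    {y : α →₀ MvPolynomial (Fin n) K} :
    substVec α π y = 0 ↔ y ∈ coeffIn α (Ideal.span (linForm K n '' T)) := by
  rw [mem_coeffIn, ← ker_substHom hπ hT, DFunLike.ext_iff]
  rfl

lemma smul_mem_coeffIn {J : Ideal (MvPolynomial (Fin n) K)} {f : MvPolynomial (Fin n) K}
    (hf : f ∈ J) (y : α →₀ MvPolynomial (Fin n) K) : f • y ∈ coeffIn α J :=
  fun a => J.mul_mem_right (y a) hf

lemma coeffIn_mono {J J' : Ideal (MvPolynomial (Fin n) K)} (h : J ≤ J') :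
    coeffIn α J ≤ coeffIn α J' := fun _ hy a => h (hy a)

lemma coeffVec_zero_eq_zero_of_mem_coeffIn {T : Set (Fin n → K)}
    {y : α →₀ MvPolynomial (Fin n) K}
    (hy : y ∈ coeffIn α (Ideal.span (linForm K n '' T))) : coeffVec K α 0 y = 0 := by
  ext a
  have hle : Ideal.span (linForm K n '' T) ≤ RingHom.ker (constantCoeff (σ := Fin n) (R := K)) := by
    rw [Ideal.span_le]
    rintro _ ⟨v, _, rfl⟩
    refine (linForm_isHomogeneous v).coeff_eq_zero ?_
    simp
  have h : constantCoeff (y a) = 0 := hle (hy a)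
  simpa [constantCoeff_eq] using h

lemma mem_coeffIn_span_insert {J : Ideal (MvPolynomial (Fin n) K)} {f : MvPolynomial (Fin n) K}
    {y : α →₀ MvPolynomial (Fin n) K} (hy : y ∈ coeffIn α (Ideal.span {f} ⊔ J)) :
    ∃ w, y - f • w ∈ coeffIn α J := by
  classical
  have h : ∀ a, ∃ g, y a - f * g ∈ J := by
    intro a
    obtain ⟨u, hu, v, hv, huv⟩ := Submodule.mem_sup.1 (hy a)
    obtain ⟨g, rfl⟩ := Ideal.mem_span_singleton.1 hu
    exact ⟨g, by rwa [← huv, add_sub_cancel_left]⟩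
  choose g hg using h
  -- The chosen quotients are replaced by 0 off the support of `y`, to keep the vector finitely
  -- supported.
  refine ⟨Finsupp.onFinset y.support (fun a => if y a = 0 then 0 else g a) ?_, fun a => ?_⟩
  · intro a ha
    rw [Finsupp.mem_support_iff]
    intro h
    simp [h] at ha
  · by_cases h : y a = 0
    · simp [h]
    · simpa [h] using hg a

lemma mem_coeffIn_of_smul {J : Ideal (MvPolynomial (Fin n) K)} (hJ : J.IsPrime)
    {f : MvPolynomial (Fin n) K} (hf : f ∉ J) {y : α →₀ MvPolynomial (Fin n) K}
    (hy : f • y ∈ coeffIn α J) : y ∈ coeffIn α J :=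
  fun a => (hJ.mem_or_mem (hy a)).resolve_left hf

/-- A degree-0 map has nonzero constant entries only between basis elements of equal degree, so the
components of `v` in other degrees may be dropped. Later arguments can thus produce a preimage
without controlling its degree. -/
lemma exists_filter_of_map_eq {deg : α → ℤ} {degβ : β → ℤ}
    (D : (α →₀ MvPolynomial (Fin n) K) →ₗ[MvPolynomial (Fin n) K]
      (β →₀ MvPolynomial (Fin n) K))
    (hD : ∀ a, D (Finsupp.single a 1) ∈ freePiece K n degβ (deg a)) {e : ℤ} {v : α →₀ K}
    (hv : reduceMap D v ∈ Finsupp.supported K K {b | degβ b = e}) :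
    ∃ u ∈ Finsupp.supported K K {a | deg a = e}, reduceMap D u = reduceMap D v := by
  classical
  refine ⟨v.filter fun a => deg a = e, fun a ha => ?_, ?_⟩
  · exact (Finset.mem_filter.1 ha).2
  ext b
  have hcoeff : ∀ a, deg a ≠ degβ b → coeff 0 (D (Finsupp.single a 1) b) = 0 := by
    intro a hab
    by_contra h
    have := hD a b 0 (mem_support_iff.2 h)
    simp only [map_zero, Nat.cast_zero] at this
    omega
  by_cases hb : degβ b = e
  · rw [reduceMap_apply, reduceMap_apply, Finsupp.sum_filter_index, Finsupp.sum,
      Finsupp.support_filter, Finset.sum_filter]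
    refine Finset.sum_congr rfl fun a _ => ?_
    split_ifs with h
    · rfl
    · rw [hcoeff a (hb ▸ h), mul_zero]
  · have h0 : reduceMap D v b = 0 := by
      by_contra h
      exact hb (hv (Finsupp.mem_support_iff.2 h))
    rw [h0, reduceMap_apply]
    refine Finset.sum_eq_zero fun a ha => ?_
    have : deg a = e := (Finset.mem_filter.1 ha).2
    simp only [hcoeff a (this ▸ Ne.symm hb), mul_zero]

end FreeModule

lemma Submodule.exists_fg_map_eq {R M N : Type*} [Ring R] [AddCommGroup M] [Module R M]
    [AddCommGroup N] [Module R N] (f : M →ₗ[R] N) {P : Submodule R M} {Q : Submodule R N}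
    (hQ : Q.FG) (h : Q ≤ P.map f) : ∃ P' ≤ P, P'.FG ∧ P'.map f = Q := by
  classical
  obtain ⟨t, rfl⟩ := hQ
  have : ∀ w ∈ t, ∃ r ∈ P, f r = w := fun w hw => h (Submodule.subset_span hw)
  choose! g hg using this
  refine ⟨Submodule.span R (t.image g : Finset M), ?_, ⟨_, rfl⟩, ?_⟩
  · rw [Submodule.span_le]
    intro x hx
    obtain ⟨w, hw, rfl⟩ := Finset.mem_image.1 hx
    exact (hg w hw).1
  · rw [Submodule.map_span, Finset.coe_image, Set.image_image,
      Set.image_congr (g := id) fun w hw => (hg w hw).2, Set.image_id]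

/-! ### Homology of the resolution modulo an ideal of linear forms -/

namespace GradedFreeResolution

variable {K : Type*} [Field K] {n : ℕ} {M : Type*} [AddCommGroup M]
  [Module K M] [Module (MvPolynomial (Fin n) K) M] {ℳ : ℤ → Submodule K M}

lemma d_d (F : GradedFreeResolution n ℳ) (i : ℕ) (y) : F.d i (F.d (i + 1) y) = 0 :=
  (F.exact_succ i).apply_apply_eq_zero y

/-- The cycles of `F ⊗_S S/J`, lifted to `F`. -/
def cyclesMod (F : GradedFreeResolution n ℳ) (J : Ideal (MvPolynomial (Fin n) K)) :
    (i : ℕ) → Submodule (MvPolynomial (Fin n) K) (F.ι i →₀ MvPolynomial (Fin n) K)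
  | 0 => ⊤
  | i + 1 => (coeffIn (F.ι i) J).comap (F.d i)

/-- The boundaries of `F ⊗_S S/J`, lifted to `F`. -/
def boundsMod (F : GradedFreeResolution n ℳ) (J : Ideal (MvPolynomial (Fin n) K)) (i : ℕ) :
    Submodule (MvPolynomial (Fin n) K) (F.ι i →₀ MvPolynomial (Fin n) K) :=
  LinearMap.range (F.d i) ⊔ coeffIn (F.ι i) J

lemma boundsMod_mono (F : GradedFreeResolution n ℳ) {J J' : Ideal (MvPolynomial (Fin n) K)}
    (h : J ≤ J') (i : ℕ) : F.boundsMod J i ≤ F.boundsMod J' i :=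
  sup_le_sup_left (coeffIn_mono h) _

lemma mem_cyclesMod_bot_succ (F : GradedFreeResolution n ℳ) {i : ℕ} {y} :
    y ∈ F.cyclesMod ⊥ (i + 1) ↔ F.d i y = 0 := by
  refine ⟨fun h => ?_, fun h => ?_⟩
  · ext1 a
    exact Ideal.mem_bot.1 (h a)
  · change F.d i y ∈ coeffIn _ _
    rw [h]
    exact zero_mem _

lemma mem_boundsMod_of_mem_cyclesMod_bot_succ (F : GradedFreeResolution n ℳ) {i : ℕ} {y}
    (hy : y ∈ F.cyclesMod ⊥ (i + 1)) : y ∈ LinearMap.range (F.d (i + 1)) :=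
  (F.exact_succ i y).1 (F.mem_cyclesMod_bot_succ.1 hy)

/-- The homology of `F ⊗_S S/J`, `J` generated by a finite set `T` of linear forms, is finitely
generated, and it vanishes in homological degrees above the size of `T`. -/
theorem exists_cyclesMod_le [Module.Finite (MvPolynomial (Fin n) K) M]
    (F : GradedFreeResolution n ℳ) (T : Finset (Fin n → K)) (i : ℕ) :
    ∃ N : Submodule (MvPolynomial (Fin n) K) (F.ι i →₀ MvPolynomial (Fin n) K), N.FG ∧
      F.cyclesMod (Ideal.span (linForm K n '' T)) i ≤
        N ⊔ F.boundsMod (Ideal.span (linForm K n '' T)) i ∧ (T.card < i → N = ⊥) := by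
  classical
  induction T using Finset.induction_on generalizing i with
  | empty =>
    rw [Finset.coe_empty, Set.image_empty, Ideal.span_empty]
    cases i with
    | zero =>
      obtain ⟨N, -, hN, hNε⟩ := Submodule.exists_fg_map_eq F.ε (P := ⊤) (Q := ⊤)
        Module.Finite.fg_top (by rw [Submodule.map_top, LinearMap.range_eq_top.2 F.ε_surjective])
      refine ⟨N, hN, fun y _ => ?_, by simp⟩
      obtain ⟨t, ht, hty⟩ : F.ε y ∈ N.map F.ε := hNε ▸ Submodule.mem_top
      have : F.ε (y - t) = 0 := by rw [map_sub, hty, sub_self]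
      rw [← add_sub_cancel t y]
      exact Submodule.add_mem_sup ht (Submodule.mem_sup_left ((F.exact_zero _).1 this))
    | succ i =>
      exact ⟨⊥, Submodule.fg_bot, fun y hy => Submodule.mem_sup_right
        (Submodule.mem_sup_left (F.mem_boundsMod_of_mem_cyclesMod_bot_succ hy)), fun _ => rfl⟩
  | insert v T hv ih =>
    set J := Ideal.span (linForm K n '' T) with hJ
    have hJ' : Ideal.span (linForm K n '' (insert v T : Finset (Fin n → K))) =
        Ideal.span {linForm K n v} ⊔ J := by
      rw [Finset.coe_insert, Set.image_insert_eq, Ideal.span_insert]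
    rw [hJ', Finset.card_insert_of_notMem hv]
    -- A form already in `J` does not change the ideal, and the bound by the number of forms only
    -- gets weaker. Otherwise the form is a nonzerodivisor modulo `J`, and the sequence
    -- `Tor_{i+1}(S/J) → Tor_{i+1}(S/(J + l)) → Tor_i(S/J)` is followed on elements.
    by_cases hmem : linForm K n v ∈ J
    · rw [sup_eq_right.2 ((Ideal.span_singleton_le_iff_mem J).2 hmem)]
      obtain ⟨N, hN, hle, hbot⟩ := ih i
      exact ⟨N, hN, hle, fun h => hbot (by omega)⟩
    have hJJ : J ≤ Ideal.span {linForm K n v} ⊔ J := le_sup_right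
    cases i with
    | zero =>
      obtain ⟨N, hN, hle, -⟩ := ih 0
      exact ⟨N, hN, hle.trans (sup_le_sup_left (F.boundsMod_mono hJJ 0) _), by simp⟩
    | succ i =>
      obtain ⟨N₁, hN₁, hle₁, hbot₁⟩ := ih (i + 1)
      obtain ⟨N₀, hN₀, hle₀, hbot₀⟩ := ih i
      set l := linForm K n v with hl
      -- Pairs `(y, w)` with `d y ≡ l w` modulo `J`: `y` is a cycle modulo `(l) + J`, and `w`
      -- represents its image under the connecting map.
      let R : Submodule (MvPolynomial (Fin n) K)
          ((F.ι (i + 1) →₀ MvPolynomial (Fin n) K) × (F.ι i →₀ MvPolynomial (Fin n) K)) :=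
        (coeffIn (F.ι i) J).comap (F.d i ∘ₗ LinearMap.fst _ _ _ - l • LinearMap.snd _ _ _)
      have hR : ∀ r, r ∈ R ↔ F.d i r.1 - l • r.2 ∈ coeffIn (F.ι i) J := fun r => Iff.rfl
      have hRcyc : ∀ r ∈ R, r.2 ∈ F.cyclesMod J i := by
        intro r hr
        cases i with
        | zero => exact Submodule.mem_top
        | succ i =>
          -- From `d (d y) = 0` one gets `l • d w ≡ 0` modulo `J`, and `l` cancels because `J` is
          -- prime.
          refine mem_coeffIn_of_smul (isPrime_span_linForm _) hmem ?_
          have := map_mem_coeffIn (F.d i) hr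
          rw [LinearMap.sub_apply, map_sub, LinearMap.comp_apply, LinearMap.smul_apply, map_smul,
            F.d_d, zero_sub] at this
          exact neg_mem_iff.1 this
      have hfg : (N₀ ⊓ R.map (LinearMap.snd _ _ _)).FG := by
        have := isNoetherian_of_fg_of_noetherian N₀ hN₀
        exact Submodule.FG.of_le hN₀ inf_le_left
      obtain ⟨R', hR'R, hR'fg, hR'map⟩ : ∃ R' ≤ R, R'.FG ∧ R'.map (LinearMap.snd _ _ _) =
          N₀ ⊓ R.map (LinearMap.snd _ _ _) :=
        Submodule.exists_fg_map_eq _ hfg inf_le_right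
      -- Left open for two uses: a finitely generated `R''` gives finite generation, and `R'' = ⊥`
      -- gives vanishing.
      have main : ∀ R'' ≤ R, N₀ ⊓ R.map (LinearMap.snd _ _ _) ≤ R''.map (LinearMap.snd _ _ _) →
          F.cyclesMod (Ideal.span {l} ⊔ J) (i + 1) ≤
            N₁ ⊔ R''.map (LinearMap.fst _ _ _) ⊔ F.boundsMod (Ideal.span {l} ⊔ J) (i + 1) := by
        intro R'' hR'' hmap y hy
        obtain ⟨w, hw⟩ := mem_coeffIn_span_insert hy
        have hyw : (y, w) ∈ R := hw
        obtain ⟨t, ht, b, hb, htb⟩ := Submodule.mem_sup.1 (hle₀ (hRcyc _ hyw))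
        replace htb : t + b = w := htb
        obtain ⟨_, ⟨x, rfl⟩, u, hu, hxu⟩ := Submodule.mem_sup.1 hb
        -- The boundary part of `w` comes from a pair whose first entry is a multiple of `l`, hence
        -- trivial modulo `(l) + J`; subtracting it leaves `w` in `N₀`.
        have hbR : (l • x, b) ∈ R := by
          rw [hR, ← hxu, map_smul, smul_add, sub_add_cancel_left]
          exact neg_mem (Submodule.smul_mem _ _ hu)
        have htR : t ∈ R.map (LinearMap.snd _ _ _) :=
          ⟨(y, w) - (l • x, b), sub_mem hyw hbR, (eq_sub_of_add_eq htb).symm⟩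
        obtain ⟨⟨y₁, t'⟩, hy₁, rfl⟩ := hmap ⟨ht, htR⟩
        have h1 : (y, w) - (l • x, b) - (y₁, t') ∈ R := sub_mem (sub_mem hyw hbR) (hR'' hy₁)
        have h2 : y - l • x - y₁ ∈ F.cyclesMod J (i + 1) := by
          have h0 : w - b - t' = 0 := by
            rw [← htb, LinearMap.snd_apply, add_sub_cancel_right, sub_self]
          rw [hR] at h1
          change F.d i _ ∈ coeffIn _ _
          simpa [h0] using h1
        have h3 := hle₁ h2
        have h4 : y = (y - l • x - y₁) + y₁ + l • x := by abel
        rw [h4]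
        refine add_mem (add_mem ?_ ?_) ?_
        · exact sup_le_sup le_sup_left (F.boundsMod_mono hJJ _) h3
        · exact Submodule.mem_sup_left (Submodule.mem_sup_right ⟨_, hy₁, rfl⟩)
        · exact Submodule.mem_sup_right (Submodule.mem_sup_right
            (smul_mem_coeffIn (Ideal.mem_sup_left (Ideal.mem_span_singleton_self l)) x))
      by_cases hcard : T.card < i
      · refine ⟨⊥, Submodule.fg_bot, ?_, fun _ => rfl⟩
        have := main ⊥ bot_le (by simp [hbot₀ hcard])
        rwa [hbot₁ (by omega), Submodule.map_bot, sup_bot_eq] at this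
      · exact ⟨_, hN₁.sup (hR'fg.map _), main R' hR'R hR'map.ge, fun h => absurd h (by omega)⟩

end GradedFreeResolution

lemma eq_zero_of_mem_polyGrading_neg {K : Type*} [Field K] {n : ℕ} {j : ℤ} (hj : j < 0)
    {f : MvPolynomial (Fin n) K} (hf : f ∈ polyGrading K n j) : f = 0 := by
  rw [← support_eq_empty, Finset.eq_empty_iff_forall_notMem]
  intro m hm
  have := hf m hm
  omega

lemma mem_coeffIn_of_span_eq_top {K : Type*} [Field K] {n : ℕ} {α : Type*} {T : Set (Fin n → K)}
    (hT : Submodule.span K T = ⊤) {y : α →₀ MvPolynomial (Fin n) K} (hy : coeffVec K α 0 y = 0) :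
    y ∈ coeffIn α (Ideal.span (linForm K n '' T)) := by
  rw [← substVec_eq_zero_iff (π := 0) (by simp) (by rw [hT, LinearMap.ker_zero])]
  ext1 a
  have h : coeff 0 (y a) = 0 := DFunLike.congr_fun hy a
  rw [substVec_apply, substHom]
  simp only [LinearMap.zero_apply, map_zero]
  rw [aeval_zero', constantCoeff_eq, h, map_zero, Finsupp.zero_apply]

/-! ### Lower bound for the degrees of a finitely generated graded module -/

section BoundedBelow

variable {K : Type*} [Field K] {n : ℕ} {M : Type*} [AddCommGroup M] [Module K M]
  [Module (MvPolynomial (Fin n) K) M] [IsScalarTower K (MvPolynomial (Fin n) K) M]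
  (ℳ : ℤ → Submodule K M)

lemma smul_mem_iSup_ge [SetLike.GradedSMul (polyGrading K n) ℳ] (c : ℤ)
    (f : MvPolynomial (Fin n) K) {x : M} (hx : x ∈ ⨆ j ≥ c, ℳ j) : f • x ∈ ⨆ j ≥ c, ℳ j := by
  induction f using MvPolynomial.induction_on' with
  | add p q hp hq => rw [add_smul]; exact add_mem hp hq
  | monomial m a =>
    have h : (⨆ j ≥ c, ℳ j) ≤
        (⨆ j ≥ c, ℳ j).comap
          ((LinearMap.lsmul (MvPolynomial (Fin n) K) M (monomial m a)).restrictScalars K) := by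
      refine iSup₂_le fun j hj y hy => ?_
      have hmem : monomial m a • y ∈ ℳ ((m.degree : ℤ) +ᵥ j) :=
        SetLike.GradedSMul.smul_mem (monomial_mem_polyGrading m a) hy
      refine Submodule.mem_iSup_of_mem ((m.degree : ℤ) +ᵥ j) (Submodule.mem_iSup_of_mem ?_ hmem)
      rw [vadd_eq_add]
      omega
    exact h hx

/-- A finitely generated graded module is bounded below. -/
lemma exists_forall_lt_eq_bot [Module.Finite (MvPolynomial (Fin n) K) M]
    [DirectSum.Decomposition ℳ] [SetLike.GradedSMul (polyGrading K n) ℳ] :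
    ∃ c : ℤ, ∀ j < c, ℳ j = ⊥ := by
  classical
  have hint := DirectSum.Decomposition.isInternal ℳ
  have hmono : ∀ {c c' : ℤ}, c' ≤ c → (⨆ j ≥ c, ℳ j) ≤ ⨆ j ≥ c', ℳ j := fun h =>
    iSup₂_le fun j hj => le_iSup₂_of_le j (h.trans hj) le_rfl
  have hx : ∀ x : M, ∃ c : ℤ, x ∈ ⨆ j ≥ c, ℳ j := by
    intro x
    have hxt : x ∈ ⨆ j, ℳ j := hint.submodule_iSup_eq_top ▸ Submodule.mem_top
    induction hxt using Submodule.iSup_induction' with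
    | mem i x hx => exact ⟨i, Submodule.mem_iSup_of_mem i (Submodule.mem_iSup_of_mem le_rfl hx)⟩
    | zero => exact ⟨0, zero_mem _⟩
    | add x y _ _ hx hy =>
      obtain ⟨c, hc⟩ := hx
      obtain ⟨c', hc'⟩ := hy
      exact ⟨min c c', add_mem (hmono (min_le_left _ _) hc) (hmono (min_le_right _ _) hc')⟩
  choose g hg using hx
  obtain ⟨t, ht⟩ := (Module.Finite.fg_top : (⊤ : Submodule (MvPolynomial (Fin n) K) M).FG)
  obtain ⟨c, hc⟩ := (t.image g).bddBelow
  have htop : ∀ x : M, x ∈ ⨆ j ≥ c, ℳ j := by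
    intro x
    have hxt : x ∈ Submodule.span (MvPolynomial (Fin n) K) (t : Set M) := ht ▸ Submodule.mem_top
    induction hxt using Submodule.span_induction with
    | mem x hx => exact hmono (hc (Finset.mem_coe.2 (Finset.mem_image_of_mem g hx))) (hg x)
    | zero => exact zero_mem _
    | add x y _ _ hx hy => exact add_mem hx hy
    | smul f x _ hx => exact smul_mem_iSup_ge ℳ c f hx
  refine ⟨c, fun j hj => ?_⟩
  rw [Submodule.eq_bot_iff]
  intro x hxj
  have hdis := hint.submodule_iSupIndep j
  refine Submodule.disjoint_def.1 hdis x hxj ?_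
  have hle : (⨆ i ≥ c, ℳ i) ≤ ⨆ i, ⨆ (_ : i ≠ j), ℳ i :=
    iSup₂_le fun i hi => le_iSup₂_of_le i (by omega) le_rfl
  exact hle (htop x)

end BoundedBelow

/-! ### Finiteness of Tor -/

namespace GradedFreeResolution

variable {K : Type*} [Field K] {n : ℕ} {M : Type*} [AddCommGroup M]
  [Module K M] [Module (MvPolynomial (Fin n) K) M] {ℳ : ℤ → Submodule K M}

lemma tensorD_eq_reduceMap (F : GradedFreeResolution n ℳ) (i : ℕ) :
    F.tensorD i = reduceMap (F.d i) := rfl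

lemma tensorD_coeffVec (F : GradedFreeResolution n ℳ) (i : ℕ) (y) :
    F.tensorD i (coeffVec K _ 0 y) = coeffVec K _ 0 (F.d i y) :=
  (coeffVec_zero_map _ _).symm

lemma torCycles_le_tensorPiece (F : GradedFreeResolution n ℳ) (i : ℕ) (j : ℤ) :
    F.torCycles i j ≤ F.tensorPiece i j := by
  cases i with
  | zero => exact le_rfl
  | succ i => exact inf_le_left

lemma torCycles_inf_range_le (F : GradedFreeResolution n ℳ) (i : ℕ) (j : ℤ) :
    F.torCycles i j ⊓ LinearMap.range (F.tensorD i) ≤ F.torBoundaries i j := by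
  rintro _ ⟨hz, v, rfl⟩
  obtain ⟨u, hu, huv⟩ := exists_filter_of_map_eq (F.d i) (F.d_homogeneous i) (v := v)
    (F.torCycles_le_tensorPiece i j hz)
  exact ⟨u, hu, huv⟩

lemma torBoundaries_le_range (F : GradedFreeResolution n ℳ) (i : ℕ) (j : ℤ) :
    F.torBoundaries i j ≤ LinearMap.range (F.tensorD i) := by
  rintro _ ⟨u, _, rfl⟩
  exact ⟨u, rfl⟩

lemma tor_eq_bot_iff (F : GradedFreeResolution n ℳ) (i : ℕ) (j : ℤ) :
    F.tor i j = ⊥ ↔ F.torCycles i j ≤ F.torBoundaries i j := by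
  rw [tor, ← LinearMap.le_ker_iff_map, Submodule.ker_mkQ]

/-- For `J` generated by all variables, `F ⊗ S/J` is `F ⊗ K`, so this is the finite generation in
`exists_cyclesMod_le` read off on constant terms. -/
lemma exists_torCycles_le [Module.Finite (MvPolynomial (Fin n) K) M]
    (F : GradedFreeResolution n ℳ) (i : ℕ) :
    ∃ N : Submodule K (F.ι i →₀ K), N.FG ∧
      ∀ j, F.torCycles i j ≤ N ⊔ LinearMap.range (F.tensorD i) := by
  classical
  let T : Finset (Fin n → K) := Finset.univ.image fun i => Pi.single i 1
  have hT : Submodule.span K (T : Set (Fin n → K)) = ⊤ := by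
    rw [← (Pi.basisFun K (Fin n)).span_eq]
    congr 1
    ext v
    simp [T]
  obtain ⟨_, ⟨t, rfl⟩, hle, -⟩ := F.exists_cyclesMod_le T i
  refine ⟨Submodule.span K (t.image (coeffVec K _ 0) : Finset _), ⟨_, rfl⟩, fun j v hv => ?_⟩
  have hcyc : monomialVec K _ 0 v ∈ F.cyclesMod (Ideal.span (linForm K n '' T)) i := by
    cases i with
    | zero => exact Submodule.mem_top
    | succ i =>
      refine mem_coeffIn_of_span_eq_top hT ?_
      rw [← tensorD_coeffVec, coeffVec_zero_monomialVec_zero]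
      exact hv.2
  obtain ⟨y, hy, b, hb, hyb⟩ := Submodule.mem_sup.1 (hle hcyc)
  obtain ⟨_, ⟨x, rfl⟩, u, hu, hxu⟩ := Submodule.mem_sup.1 hb
  rw [← coeffVec_zero_monomialVec_zero (n := n) v, ← hyb, ← hxu, map_add, map_add,
    coeffVec_zero_eq_zero_of_mem_coeffIn hu, add_zero, ← tensorD_coeffVec]
  refine Submodule.add_mem_sup ?_ ⟨_, rfl⟩
  clear hyb
  induction hy using Submodule.span_induction with
  | mem y hy => exact Submodule.subset_span (Finset.mem_coe.2 (Finset.mem_image_of_mem _ hy))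
  | zero => rw [map_zero]; exact zero_mem _
  | add y z _ _ hy hz => rw [map_add]; exact add_mem hy hz
  | smul f y _ hy =>
    have : coeffVec K _ 0 (f • y) = coeff 0 f • coeffVec K _ 0 y := by
      ext a
      simp [← constantCoeff_eq]
    rw [this]
    exact Submodule.smul_mem _ _ hy

/-- The modules `F_i` may have infinite rank, and `finrank` is 0 on infinite-dimensional spaces;
finiteness is what lets a zero Betti number mean that Tor vanishes. -/
lemma finite_tor [Module.Finite (MvPolynomial (Fin n) K) M] (F : GradedFreeResolution n ℳ)
    (i : ℕ) (j : ℤ) : Module.Finite K (F.tor i j) := by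
  obtain ⟨N, hN, hle⟩ := F.exists_torCycles_le i
  let f := Submodule.mapQ (F.torBoundaries i j) (LinearMap.range (F.tensorD i)) LinearMap.id
    (F.torBoundaries_le_range i j)
  have hf : ∀ x ∈ F.tor i j, f x ∈ N.map (LinearMap.range (F.tensorD i)).mkQ := by
    rintro _ ⟨z, hz, rfl⟩
    have := Submodule.mem_map_of_mem (f := (LinearMap.range (F.tensorD i)).mkQ) (hle j hz)
    rwa [Submodule.map_sup, LinearMap.le_ker_iff_map.1 (Submodule.ker_mkQ _).ge,
      sup_bot_eq] at this
  have : Module.Finite K (N.map (LinearMap.range (F.tensorD i)).mkQ) :=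
    Module.Finite.iff_fg.2 (hN.map _)
  refine Module.Finite.of_injective (f.restrict hf) ?_
  rw [← LinearMap.ker_eq_bot, LinearMap.ker_eq_bot']
  rintro ⟨_, z, hz, rfl⟩ h
  have h0 : f ((F.torBoundaries i j).mkQ z) = 0 := congrArg Subtype.val h
  have hzr : z ∈ LinearMap.range (F.tensorD i) := (Submodule.Quotient.mk_eq_zero _).1 h0
  ext1
  exact (Submodule.Quotient.mk_eq_zero _).2 (F.torCycles_inf_range_le i j ⟨hz, hzr⟩)

lemma betti_eq_zero_iff [Module.Finite (MvPolynomial (Fin n) K) M] (F : GradedFreeResolution n ℳ)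
    (i : ℕ) (j : ℤ) : F.betti i j = 0 ↔ F.torCycles i j ≤ F.torBoundaries i j := by
  have := F.finite_tor i j
  rw [betti, Submodule.finrank_eq_zero, tor_eq_bot_iff]

/-! ### Contractibility of the resolution in low degrees -/

/-- The submodule of `F_i` spanned by the basis elements of degree less than `c`. -/
def low (F : GradedFreeResolution n ℳ) (c : ℤ) (i : ℕ) :
    Submodule (MvPolynomial (Fin n) K) (F.ι i →₀ MvPolynomial (Fin n) K) :=
  Finsupp.supported _ _ {a | F.deg i a < c}

lemma mem_low (F : GradedFreeResolution n ℳ) {c : ℤ} {i : ℕ} {y} :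
    y ∈ F.low c i ↔ ∀ a, c ≤ F.deg i a → y a = 0 := by
  rw [low, Finsupp.mem_supported']
  simp

/-- An entry of the differential from a basis element of degree below `c` to one of degree at least
`c` would have negative degree. -/
lemma d_mem_low (F : GradedFreeResolution n ℳ) {c : ℤ} {i : ℕ} {y} (hy : y ∈ F.low c (i + 1)) :
    F.d i y ∈ F.low c i := by
  rw [mem_low] at hy ⊢
  intro b hb
  rw [map_eq_sum]
  refine Finset.sum_eq_zero fun a ha => ?_
  have hac : F.deg (i + 1) a < c := by
    by_contra h
    exact Finsupp.mem_support_iff.1 ha (hy a (not_lt.1 h))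
  simp only [eq_zero_of_mem_polyGrading_neg (by omega) (F.d_homogeneous i a b), mul_zero]

lemma map_eq_of_forall_single (F : GradedFreeResolution n ℳ) {c : ℤ} {i : ℕ} {N : Type*}
    [AddCommGroup N] [Module (MvPolynomial (Fin n) K) N]
    {f g : (F.ι i →₀ MvPolynomial (Fin n) K) →ₗ[MvPolynomial (Fin n) K] N}
    (h : ∀ a, F.deg i a < c → f (Finsupp.single a 1) = g (Finsupp.single a 1)) {y}
    (hy : y ∈ F.low c i) : f y = g y := by
  rw [low, Finsupp.supported_eq_span_single] at hy
  refine LinearMap.eqOn_span ?_ hy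
  rintro _ ⟨a, ha, rfl⟩
  exact h a ha

/-- For a low basis element `e_a`, the vector `d e_a` is a low cycle, so `e_a - h' (d e_a)` is a
cycle and exactness supplies the value of `h` at `e_a`. -/
lemma exists_homotopy_step (F : GradedFreeResolution n ℳ) {c : ℤ} {i : ℕ}
    {h' : (F.ι i →₀ MvPolynomial (Fin n) K) →ₗ[MvPolynomial (Fin n) K]
      (F.ι (i + 1) →₀ MvPolynomial (Fin n) K)}
    (hh' : ∀ y ∈ F.low c i, y ∈ F.cyclesMod ⊥ i → F.d i (h' y) = y) :
    ∃ h : (F.ι (i + 1) →₀ MvPolynomial (Fin n) K) →ₗ[MvPolynomial (Fin n) K]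
      (F.ι (i + 2) →₀ MvPolynomial (Fin n) K),
      ∀ y ∈ F.low c (i + 1), F.d (i + 1) (h y) + h' (F.d i y) = y := by
  have : ∀ a, ∃ x, F.deg (i + 1) a < c → F.d (i + 1) x =
      Finsupp.single a 1 - h' (F.d i (Finsupp.single a 1)) := by
    intro a
    by_cases ha : F.deg (i + 1) a < c
    · have hcyc : F.d i (Finsupp.single a 1) ∈ F.cyclesMod ⊥ i := by
        cases i with
        | zero => exact Submodule.mem_top
        | succ i => exact F.mem_cyclesMod_bot_succ.2 (F.d_d _ _)
      have hlow : F.d i (Finsupp.single a 1) ∈ F.low c i :=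
        F.d_mem_low (Finsupp.single_mem_supported _ _ ha)
      obtain ⟨x, hx⟩ := (F.exact_succ i
        (Finsupp.single a 1 - h' (F.d i (Finsupp.single a 1)))).1
        (by rw [map_sub, hh' _ hlow hcyc, sub_self])
      exact ⟨x, fun _ => hx⟩
    · exact ⟨0, fun h => absurd h ha⟩
  choose x hx using this
  refine ⟨Finsupp.linearCombination _ x, fun y hy => ?_⟩
  refine F.map_eq_of_forall_single
    (f := F.d (i + 1) ∘ₗ Finsupp.linearCombination _ x + h' ∘ₗ F.d i) (g := LinearMap.id)
    (fun a ha => ?_) hy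
  simp [hx a ha]

/-- The induction starts because `ε` kills basis elements of degree below `c`, so they are
boundaries. It continues because the term `h' (d y)` disappears on cycles. -/
lemma exists_contraction (F : GradedFreeResolution n ℳ) {c : ℤ} (hc : ∀ j < c, ℳ j = ⊥) (i : ℕ) :
    ∃ h : (F.ι i →₀ MvPolynomial (Fin n) K) →ₗ[MvPolynomial (Fin n) K]
      (F.ι (i + 1) →₀ MvPolynomial (Fin n) K),
      ∀ y ∈ F.low c i, y ∈ F.cyclesMod ⊥ i → F.d i (h y) = y := by
  induction i with
  | zero =>
    have : ∀ a, ∃ x, F.deg 0 a < c → F.d 0 x = Finsupp.single a 1 := by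
      intro a
      by_cases ha : F.deg 0 a < c
      · obtain ⟨x, hx⟩ := (F.exact_zero (Finsupp.single a 1)).1
          (by simpa [hc _ ha] using F.ε_homogeneous a)
        exact ⟨x, fun _ => hx⟩
      · exact ⟨0, fun h => absurd h ha⟩
    choose x hx using this
    refine ⟨Finsupp.linearCombination _ x, fun y hy _ => ?_⟩
    refine F.map_eq_of_forall_single
      (f := F.d 0 ∘ₗ Finsupp.linearCombination _ x) (g := LinearMap.id) (fun a ha => ?_) hy
    simp [hx a ha]
  | succ i ih =>
    obtain ⟨h', hh'⟩ := ih
    obtain ⟨h, hh⟩ := F.exists_homotopy_step hh'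
    refine ⟨h, fun y hy hcyc => ?_⟩
    have := hh y hy
    rwa [F.mem_cyclesMod_bot_succ.1 hcyc, map_zero, add_zero] at this

/-- Below the degrees of `M` the resolution is contractible. -/
lemma exists_homotopy (F : GradedFreeResolution n ℳ) {c : ℤ} (hc : ∀ j < c, ℳ j = ⊥) (i : ℕ) :
    ∃ (h : (F.ι (i + 1) →₀ MvPolynomial (Fin n) K) →ₗ[MvPolynomial (Fin n) K]
        (F.ι (i + 2) →₀ MvPolynomial (Fin n) K))
      (h' : (F.ι i →₀ MvPolynomial (Fin n) K) →ₗ[MvPolynomial (Fin n) K]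
        (F.ι (i + 1) →₀ MvPolynomial (Fin n) K)),
      ∀ y ∈ F.low c (i + 1), F.d (i + 1) (h y) + h' (F.d i y) = y := by
  obtain ⟨h', hh'⟩ := F.exists_contraction hc i
  obtain ⟨h, hh⟩ := F.exists_homotopy_step hh'
  exact ⟨h, h', hh⟩

lemma torCycles_le_torBoundaries_of_lt (F : GradedFreeResolution n ℳ) {c : ℤ}
    (hc : ∀ j < c, ℳ j = ⊥) (i : ℕ) {j : ℤ} (hj : j < c) :
    F.torCycles i j ≤ F.torBoundaries i j := by
  intro v hv
  refine F.torCycles_inf_range_le i j ⟨hv, ?_⟩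
  have hlow : monomialVec K _ 0 v ∈ F.low c i := by
    rw [mem_low]
    intro a ha
    have : v a = 0 := by
      by_contra h
      have h' : F.deg i a = j := F.torCycles_le_tensorPiece i j hv (Finsupp.mem_support_iff.2 h)
      omega
    rw [monomialVec_apply, this, map_zero]
  cases i with
  | zero =>
    obtain ⟨h, hh⟩ := F.exists_contraction hc 0
    exact ⟨coeffVec K _ 0 (h (monomialVec K _ 0 v)), by
      rw [tensorD_coeffVec, hh _ hlow Submodule.mem_top, coeffVec_zero_monomialVec_zero]⟩
  | succ i =>
    obtain ⟨h, h', hh⟩ := F.exists_homotopy hc i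
    have h0 : coeffVec K _ 0 (h' (F.d i (monomialVec K _ 0 v))) = 0 := by
      rw [coeffVec_zero_map, ← tensorD_coeffVec, coeffVec_zero_monomialVec_zero,
        LinearMap.mem_ker.1 hv.2, map_zero]
    refine ⟨coeffVec K _ 0 (h (monomialVec K _ 0 v)), ?_⟩
    have := congrArg (coeffVec K _ 0) (hh _ hlow)
    rwa [map_add, h0, add_zero, coeffVec_zero_monomialVec_zero, ← tensorD_coeffVec] at this

end GradedFreeResolution

/-! ### Raising the order of a differential, and vanishing of Tor -/

lemma mem_finsuppAntidiag_univ_iff {σ : Type*} [Fintype σ] [DecidableEq σ] {μ : σ →₀ ℕ}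
    {s : ℕ} : μ ∈ Finset.univ.finsuppAntidiag s ↔ μ.degree = s := by
  simp [Finset.mem_finsuppAntidiag, Finsupp.degree_eq_sum]

lemma degree_eq_one_iff_exists_single {σ : Type*} {μ : σ →₀ ℕ} :
    μ.degree = 1 ↔ ∃ i, μ = Finsupp.single i 1 := by
  have h := Set.ext_iff.1 (Finsupp.range_single_one (σ := σ)) μ
  simpa [eq_comm] using h.symm

lemma coeffVec_single_substVec {K : Type*} [Field K] {n : ℕ} {α : Type*}
    (π : (Fin n → K) →ₗ[K] (Fin n → K)) (y : α →₀ MvPolynomial (Fin n) K) (j : Fin n) :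
    coeffVec K α (Finsupp.single j 1) (substVec α π y) =
      ∑ i, π (Pi.single i 1) j • coeffVec K α (Finsupp.single i 1) y := by
  classical
  have h : Finset.univ.finsuppAntidiag (Finsupp.single j 1 : Fin n →₀ ℕ).degree =
      Finset.univ.image fun i : Fin n => Finsupp.single i 1 := by
    ext μ
    rw [mem_finsuppAntidiag_univ_iff, Finsupp.degree_single, degree_eq_one_iff_exists_single]
    simp [eq_comm]
  rw [coeffVec_substVec, h, Finset.sum_image fun a _ b _ hab =>
    Finsupp.single_left_injective one_ne_zero hab]
  refine Finset.sum_congr rfl fun i _ => ?_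
  have hX : substHom π (monomial (Finsupp.single i 1) 1) = linForm K n (π (Pi.single i 1)) := by
    rw [← substHom_linForm, linForm_single, X]
  rw [hX, coeff_linForm_single]

namespace GradedFreeResolution

variable {K : Type*} [Field K] {n : ℕ} {M : Type*} [AddCommGroup M]
  [Module K M] [Module (MvPolynomial (Fin n) K) M] {ℳ : ℤ → Submodule K M}

/-- Leading coefficients commute with the reduced differential, so `d (d z) = 0` makes them cycles.
An entry of order `s` in a vector of degree `e` sits at a basis element of degree `e - s`. -/
lemma coeffVec_substVec_mem_torCycles (F : GradedFreeResolution n ℳ) {q : ℕ} {e : ℤ}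
    {π : (Fin n → K) →ₗ[K] (Fin n → K)} {z} (hz : z ∈ freePiece K n (F.deg (q + 1)) e) {s : ℕ}
    (hord : substVec _ π (F.d q z) ∈ orderGE K n _ s) {μ : Fin n →₀ ℕ} (hμ : μ.degree = s) :
    coeffVec K _ μ (substVec _ π (F.d q z)) ∈ F.torCycles q (e - s) := by
  have hpiece : coeffVec K _ μ (substVec _ π (F.d q z)) ∈ F.tensorPiece q (e - s) :=
    hμ ▸ coeffVec_mem_supported
      (substVec_mem_freePiece π (map_mem_freePiece _ (F.d_homogeneous q) hz)) μ
  cases q with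
  | zero => exact hpiece
  | succ q =>
    refine ⟨hpiece, ?_⟩
    change F.tensorD q _ = 0
    rw [tensorD_eq_reduceMap, ← coeffVec_substVec_map _ hord hμ, F.d_d, map_zero,
      map_zero]

/-- If the leading coefficients of `d z` modulo linear forms are boundaries, then `z` can be
changed by elements of positive order so that the order of `d z` increases. -/
lemma exists_orderGE_succ (F : GradedFreeResolution n ℳ) {q : ℕ} {e : ℤ}
    {π : (Fin n → K) →ₗ[K] (Fin n → K)} (hπ : ∀ v, π (π v) = π v) {z}
    (hz : z ∈ freePiece K n (F.deg (q + 1)) e) {s : ℕ} (hs : 1 ≤ s)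
    (hord : substVec _ π (F.d q z) ∈ orderGE K n _ s)
    (hb : ∀ μ : Fin n →₀ ℕ, μ.degree = s →
      coeffVec K _ μ (substVec _ π (F.d q z)) ∈ F.torBoundaries q (e - s)) :
    ∃ z' ∈ freePiece K n (F.deg (q + 1)) e, coeffVec K _ 0 z' = coeffVec K _ 0 z ∧
      substVec _ π (F.d q z') ∈ orderGE K n _ (s + 1) := by
  classical
  choose! v hv hvd using hb
  -- The preimages of the degree-`s` coefficients, placed at their monomials; as `s ≥ 1`,
  -- subtracting `Y` leaves the constant terms of `z` alone.
  set Y := ∑ μ ∈ (Finset.univ : Finset (Fin n)).finsuppAntidiag s,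
    monomialVec K (F.ι (q + 1)) μ (v μ) with hY
  have hcoeff : ∀ ν, coeffVec K _ ν Y = if ν.degree = s then v ν else 0 := by
    intro ν
    simp only [hY, map_sum, coeffVec_monomialVec, Finset.sum_ite_eq',
      mem_finsuppAntidiag_univ_iff]
  have hYord : substVec _ π Y ∈ orderGE K n _ s := by
    rw [mem_orderGE]
    intro ν hν
    rw [coeffVec_substVec]
    refine Finset.sum_eq_zero fun μ hμ => ?_
    rw [mem_finsuppAntidiag_univ_iff] at hμ
    rw [hcoeff, if_neg (by omega), smul_zero]
  refine ⟨z - Y, sub_mem hz (Submodule.sum_mem _ fun μ hμ => ?_), ?_, ?_⟩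
  · rw [mem_finsuppAntidiag_univ_iff] at hμ
    refine monomialVec_mem_freePiece μ ?_
    rw [hμ]
    exact hv μ hμ
  · rw [map_sub, hcoeff, if_neg (by simp; omega), sub_zero]
  · rw [mem_orderGE]
    intro ν hν
    rw [map_sub (F.d q), map_sub (substVec _ π), map_sub]
    rcases Nat.lt_succ_iff_lt_or_eq.1 hν with h | h
    · rw [mem_orderGE.1 hord ν h, mem_orderGE.1 (substVec_map_mem_orderGE _ hYord) ν h, sub_zero]
    -- The `v μ` were chosen for the already reduced vector, whereas `Y` is still to be reduced.
    -- Idempotence lets `d z` be reduced a second time, and the two sums then match term by term.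
    · rw [coeffVec_substVec_map _ hYord h, ← substVec_substVec hπ (F.d q z), coeffVec_substVec,
        coeffVec_substVec, map_sum (reduceMap (F.d q)), sub_eq_zero]
      refine Finset.sum_congr rfl fun μ hμ => ?_
      rw [mem_finsuppAntidiag_univ_iff, h] at hμ
      rw [hcoeff, if_pos hμ, map_smul, ← tensorD_eq_reduceMap, hvd μ hμ]

/-- The reduction of `z` is a boundary if the order of `d z` modulo fewer linear forms than the
homological degree is large. -/
lemma coeffVec_mem_range_of_orderGE [Module.Finite (MvPolynomial (Fin n) K) M]
    (F : GradedFreeResolution n ℳ) {c : ℤ} (hc : ∀ j < c, ℳ j = ⊥) {q : ℕ} {e : ℤ}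
    {π : (Fin n → K) →ₗ[K] (Fin n → K)} (hπ : ∀ v, π (π v) = π v) {T : Finset (Fin n → K)}
    (hT : Submodule.span K (T : Set (Fin n → K)) = LinearMap.ker π) (hTq : T.card ≤ q) {z}
    (hz : z ∈ freePiece K n (F.deg (q + 1)) e) {s : ℕ} (hs : 1 ≤ s) (hsc : e - s < c)
    (hord : substVec _ π (F.d q z) ∈ orderGE K n _ s) :
    coeffVec K _ 0 z ∈ LinearMap.range (F.tensorD (q + 1)) := by
  set u := substVec _ π (F.d q z) with hu
  -- A nonzero entry of `u` has order at least `s`, which forces its basis element to have degree at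
  -- most `e - s < c`.
  have hlow : u ∈ F.low c q := by
    rw [mem_low]
    intro a ha
    ext μ
    rw [coeff_zero]
    by_contra h
    have h1 := substVec_mem_freePiece π (map_mem_freePiece _ (F.d_homogeneous q) hz) a μ
      (mem_support_iff.2 h)
    have h2 : ¬ μ.degree < s := fun hμ => h (coeff_eq_zero_of_mem_orderGE hord a hμ)
    omega
  obtain ⟨h, hh⟩ : ∃ h : (F.ι q →₀ MvPolynomial (Fin n) K) →ₗ[MvPolynomial (Fin n) K]
      (F.ι (q + 1) →₀ MvPolynomial (Fin n) K), substVec _ π (F.d q (h u)) = u := by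
    have huu : substVec _ π u = u := substVec_substVec hπ _
    cases q with
    | zero =>
      obtain ⟨h, hh⟩ := F.exists_contraction hc 0
      exact ⟨h, by rw [hh u hlow Submodule.mem_top, huu]⟩
    | succ q =>
      obtain ⟨h, h', hh⟩ := F.exists_homotopy hc q
      refine ⟨h, ?_⟩
      have h0 : substVec _ π (F.d q u) = 0 := by
        rw [hu, substVec_map_substVec hπ, F.d_d, map_zero]
      -- Since `u` is only a cycle modulo `J`, the second homotopy term need not vanish in `F`; it
      -- vanishes modulo `J`, which is enough.
      have h1 : substVec _ π (h' (F.d q u)) = 0 := by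
        rw [← substVec_map_substVec hπ, h0, map_zero, map_zero]
      have h2 := congrArg (substVec _ π) (hh u hlow)
      rwa [map_add, h1, add_zero, huu] at h2
  have hcyc : z - h u ∈ F.cyclesMod (Ideal.span (linForm K n '' T)) (q + 1) := by
    refine (substVec_eq_zero_iff hπ hT).1 ?_
    rw [map_sub, map_sub, hh, hu, sub_self]
  obtain ⟨N, -, hle, hN⟩ := F.exists_cyclesMod_le T (q + 1)
  rw [hN (by omega), bot_sup_eq] at hle
  obtain ⟨_, ⟨x, rfl⟩, w, hw, hxw⟩ := Submodule.mem_sup.1 (hle hcyc)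
  -- `u` has order at least `s ≥ 1`, so `h u` contributes nothing to the constant terms.
  have hu0 : coeffVec K _ 0 (h u) = 0 := by
    rw [coeffVec_zero_map, mem_orderGE.1 hord 0 (by simp; omega), map_zero]
  refine ⟨coeffVec K _ 0 x, ?_⟩
  have := congrArg (coeffVec K _ 0) hxw
  rwa [map_add, coeffVec_zero_eq_zero_of_mem_coeffIn hw, add_zero, map_sub, hu0, sub_zero,
    ← tensorD_coeffVec] at this

/-- The vanishing of `Tor_q` makes every leading coefficient a boundary, so the order of `d z`
modulo the forms can be raised indefinitely without touching the constant terms of `z`. -/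
lemma coeffVec_mem_range [Module.Finite (MvPolynomial (Fin n) K) M]
    (F : GradedFreeResolution n ℳ) {c : ℤ} (hc : ∀ j < c, ℳ j = ⊥) {q : ℕ} {e : ℤ}
    {π : (Fin n → K) →ₗ[K] (Fin n → K)} (hπ : ∀ v, π (π v) = π v) {T : Finset (Fin n → K)}
    (hT : Submodule.span K (T : Set (Fin n → K)) = LinearMap.ker π) (hTq : T.card ≤ q) {z}
    (hz : z ∈ freePiece K n (F.deg (q + 1)) e) {s₀ : ℕ} (hs : 1 ≤ s₀)
    (hord : substVec _ π (F.d q z) ∈ orderGE K n _ s₀)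
    (hvan : ∀ s : ℕ, s₀ ≤ s → F.torCycles q (e - s) ≤ F.torBoundaries q (e - s)) :
    coeffVec K _ 0 z ∈ LinearMap.range (F.tensorD (q + 1)) := by
  have key : ∀ t : ℕ, ∃ z' ∈ freePiece K n (F.deg (q + 1)) e,
      coeffVec K _ 0 z' = coeffVec K _ 0 z ∧
      substVec _ π (F.d q z') ∈ orderGE K n _ (s₀ + t) := by
    intro t
    induction t with
    | zero => exact ⟨z, hz, rfl, hord⟩
    | succ t ih =>
      obtain ⟨z', hz', h0, hord'⟩ := ih
      obtain ⟨z'', hz'', h0', hord''⟩ := F.exists_orderGE_succ hπ hz' (by omega) hord'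
        fun μ hμ => hvan _ (by omega) (F.coeffVec_substVec_mem_torCycles hz' hord' hμ)
      exact ⟨z'', hz'', h0'.trans h0, hord''⟩
  -- This many steps bring the degree `e - (s₀ + t)` below `c`.
  obtain ⟨z', hz', h0, hord'⟩ := key ((e - c).toNat + 1)
  rw [← h0]
  exact F.coeffVec_mem_range_of_orderGE hc hπ hT hTq hz' (by omega) (by omega) hord'

lemma monomialVec_zero_mem_freePiece (F : GradedFreeResolution n ℳ) {i : ℕ} {e : ℤ} {v}
    (hv : v ∈ F.torCycles i e) : monomialVec K _ 0 v ∈ freePiece K n (F.deg i) e := by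
  refine monomialVec_mem_freePiece 0 ?_
  simpa only [map_zero, Nat.cast_zero, sub_zero, tensorPiece] using
    F.torCycles_le_tensorPiece i e hv

lemma d_monomialVec_mem_orderGE_one (F : GradedFreeResolution n ℳ) {q : ℕ} {e : ℤ} {v}
    (hv : v ∈ F.torCycles (q + 1) e) (π : (Fin n → K) →ₗ[K] (Fin n → K)) :
    substVec _ π (F.d q (monomialVec K _ 0 v)) ∈ orderGE K n _ 1 := by
  rw [mem_orderGE]
  intro μ hμ
  obtain rfl : μ = 0 := by rwa [Nat.lt_one_iff, Finsupp.degree_eq_zero_iff] at hμ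
  rw [coeffVec_zero_substVec, ← tensorD_coeffVec, coeffVec_zero_monomialVec_zero]
  exact hv.2

/-- If `Tor_k` vanishes below the degree `k + D`, then `Tor_i` vanishes below `i + D`, `i ≥ k`. -/
lemma torCycles_le_of_forall_lt [Module.Finite (MvPolynomial (Fin n) K) M]
    (F : GradedFreeResolution n ℳ) {c : ℤ} (hc : ∀ j < c, ℳ j = ⊥) {k : ℕ} {D : ℤ}
    (hk : ∀ j < D, F.torCycles k (k + j) ≤ F.torBoundaries k (k + j)) {i : ℕ} (hi : k ≤ i) :
    ∀ j < D, F.torCycles i (i + j) ≤ F.torBoundaries i (i + j) := by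
  induction i, hi using Nat.le_induction with
  | base => exact hk
  | succ i hi ih =>
    intro j hj v hv
    refine F.torCycles_inf_range_le _ _ ⟨hv, ?_⟩
    rw [← coeffVec_zero_monomialVec_zero (n := n) v]
    refine F.coeffVec_mem_range hc (π := LinearMap.id) (T := ∅) (fun _ => rfl) (by simp) (by simp)
      (F.monomialVec_zero_mem_freePiece hv) le_rfl (F.d_monomialVec_mem_orderGE_one hv _)
      fun s hs => ?_
    have := ih (j + 1 - s) (by omega)
    rwa [show (i : ℤ) + (j + 1 - s) = ((i + 1 : ℕ) : ℤ) + j - s by push_cast; ring] at this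

/-- If `Tor_q` vanishes below the degree `q + D` and has dimension at most `q` in this degree, then
`Tor_{q+1}` vanishes in degree `q + 1 + D`. -/
lemma torCycles_succ_le_of_betti_le [Module.Finite (MvPolynomial (Fin n) K) M]
    (F : GradedFreeResolution n ℳ) {c : ℤ} (hc : ∀ j < c, ℳ j = ⊥) {q : ℕ} {e : ℤ}
    (hvan : ∀ j < e - 1, F.torCycles q j ≤ F.torBoundaries q j) (hq : F.betti q (e - 1) ≤ q) :
    F.torCycles (q + 1) e ≤ F.torBoundaries (q + 1) e := by
  classical
  intro v hv
  refine F.torCycles_inf_range_le _ _ ⟨hv, ?_⟩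
  rw [← coeffVec_zero_monomialVec_zero (n := n) v]
  have hz := F.monomialVec_zero_mem_freePiece hv
  have hord := F.d_monomialVec_mem_orderGE_one hv
  set z : F.ι (q + 1) →₀ MvPolynomial (Fin n) K := monomialVec K _ 0 v
  have := F.finite_tor q (e - 1)
  let b := Module.finBasis K (F.tor q (e - 1))
  have hw : ∀ i : Fin n, coeffVec K _ (Finsupp.single i 1) (F.d q z) ∈ F.torCycles q (e - 1) := by
    intro i
    have := F.coeffVec_substVec_mem_torCycles (π := LinearMap.id) hz (hord _)
      (μ := Finsupp.single i 1) (Finsupp.degree_single i 1)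
    rwa [substVec_id] at this
  let cl : Fin n → F.tor q (e - 1) := fun i => ⟨_, Submodule.mem_map_of_mem (hw i)⟩
  -- The form `l a` collects the `a`-th coordinates of the classes of the coefficients of `d z` at
  -- `x_1, …, x_n`. There are as many forms as the Betti number, hence at most `q`.
  let l : Fin (Module.finrank K (F.tor q (e - 1))) → Fin n → K := fun a i => b.repr (cl i) a
  let T := Finset.univ.image l
  have hTq : T.card ≤ q := Finset.card_image_le.trans (by simpa [betti] using hq)
  obtain ⟨π, hπ, hker⟩ := exists_idempotent_ker_eq (Submodule.span K (T : Set (Fin n → K)))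
  have hl : ∀ a j, ∑ i, π (Pi.single i 1) j * l a i = 0 := by
    intro a j
    have h0 : π (l a) = 0 := by
      rw [← LinearMap.mem_ker, hker]
      exact Submodule.subset_span (Finset.mem_coe.2 (Finset.mem_image_of_mem l (Finset.mem_univ a)))
    have h1 := congrFun h0 j
    rw [pi_eq_sum_univ' (l a), map_sum, Finset.sum_apply] at h1
    simpa [mul_comm, Pi.single_apply, Pi.single, Function.update, eq_comm] using h1
  -- Since `π` kills every `l a`, the linear part of `d z` has zero class after the substitution.
  have hcl : ∀ j, ∑ i, π (Pi.single i 1) j • cl i = 0 := by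
    intro j
    apply b.repr.injective
    ext a
    simpa [Finsupp.finsetSum_apply] using hl a j
  obtain ⟨z', hz', h0, hord'⟩ := F.exists_orderGE_succ hπ hz le_rfl (hord π) (by
    intro μ hμ
    obtain ⟨j, rfl⟩ := degree_eq_one_iff_exists_single.1 hμ
    rw [coeffVec_single_substVec, ← Submodule.Quotient.mk_eq_zero, ← Submodule.mkQ_apply, map_sum]
    simpa [cl] using congrArg Subtype.val (hcl j))
  rw [← h0]
  exact F.coeffVec_mem_range hc hπ hker.symm hTq hz' (by omega) hord'
    fun s hs => hvan _ (by omega)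

end GradedFreeResolution

end

/-! ### The lower bound for the linear Betti numbers -/

theorem corollary2p6 {K : Type*} [Field K] {n : ℕ} {M : Type*} [AddCommGroup M] [Nontrivial M]
    [Module K M] [Module (MvPolynomial (Fin n) K) M] [IsScalarTower K (MvPolynomial (Fin n) K) M]
    [Module.Finite (MvPolynomial (Fin n) K) M]
    (ℳ : ℤ → Submodule K M) [DirectSum.Decomposition ℳ] [SetLike.GradedSMul (polyGrading K n) ℳ]
    (F : GradedFreeResolution n ℳ) (k : ℕ) (hk : k ≤ n) (p : ℕ) (hp : k < p)
    (hβ : F.linBetti k p ≠ 0) :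
    p ≤ F.linBetti k (p - 1) := by
  obtain ⟨c, hc⟩ := exists_forall_lt_eq_bot (n := n) ℳ
  obtain ⟨q, rfl⟩ : ∃ q, p = q + 1 := ⟨p - 1, by omega⟩
  rw [Nat.add_sub_cancel]
  by_contra! hlt
  -- Needed for `sInf` to be a genuine infimum: `Tor_k` vanishes in degrees below `c`, so only `j ≥
  -- c - k` can occur.
  have hbdd : BddBelow ({j : ℤ | F.betti k (k + j) ≠ 0} ∪ {F.reg}) := by
    refine BddBelow.union ⟨c - k, fun j hj => ?_⟩ bddBelow_singleton
    by_contra h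
    exact hj ((F.betti_eq_zero_iff k _).2 (F.torCycles_le_torBoundaries_of_lt hc k (by omega)))
  have hvan : ∀ j < F.initialDegree k, F.torCycles k (k + j) ≤ F.torBoundaries k (k + j) := by
    intro j hj
    rw [← F.betti_eq_zero_iff]
    by_contra h
    exact notMem_of_lt_csInf hj hbdd (Or.inl h)
  have he : ((q + 1 : ℕ) : ℤ) + F.initialDegree k - 1 = q + F.initialDegree k := by
    push_cast
    ring
  refine hβ ((F.betti_eq_zero_iff _ _).2 (F.torCycles_succ_le_of_betti_le hc (fun j hj => ?_) ?_))
  · have := F.torCycles_le_of_forall_lt hc hvan (i := q) (by omega) (j - q) (by omega)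
    rwa [add_sub_cancel] at this
  · rw [he]
    exact Nat.lt_succ_iff.1 hlt
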